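/- **Theorem 3.1.** Let $A$ be an $f$-algebra: a real Riesz space (vector lattice) with an associative bilinear multiplication, not necessarily unital, such that $a,b\ge 0$ implies $ab\ge 0$, and $a\wedge b=0$, $c\ge 0$ imply $(ca)\wedge b=(ac)\wedge b=0$. Let $A^{\sim}$ be its order dual, that is, the Riesz space of all order bounded linear functionals on $A$, and assume that $A^{\sim}$ separates the points of $A$. Let $(A^{\sim})^{\sim}_n$ be the space of all order continuous functionals in the order bidual $(A^{\sim})^{\sim}$. For $a\in A$, $f\in A^{\sim}$ and $G\in(A^{\sim})^{\sim}_n$ define $f\cdot a\in A^{\sim}$ and $G\cdot f\in A^{\sim}$ by $$(f\cdot a)(b)=f(ab)\quad(b\in A),\qquad (G\cdot f)(a)=G(f\cdot a)\quad(a\in A).$$ An orthomorphism of a Riesz space $L$ is an order bounded linear operator $\pi:L\to L$ such that $|x|\wedge|y|=0$ implies $|\pi(x)|\wedge|y|=0$. An order bounded linear operator $T:A^{\sim}\to A^{\sim}$ is called $f$-linear with respect to $(A^{\sim})^{\sim}_n$ if $T(G\cdot f)=G\cdot T(f)$ for all $G\in(A^{\sim})^{\sim}_n$ and $f\in A^{\sim}$.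 Then every orthomorphism $\pi$ of $A^{\sim}$ is $f$-linear with respect to $(A^{\sim})^{\sim}_n$; that is, $\pi$ is order bounded and $$\pi(G\cdot f)=G\cdot\pi(f)\qquad\text{for all } G\in(A^{\sim})^{\sim}_n \text{ and } f\in A^{\sim}.$$ -/

import Mathlib

open Filter Topology

universe u v

/-! ## Order bounded operators and orthomorphisms

A Riesz space (real vector lattice) is a type `E` with
`[AddCommGroup E] [Lattice E] [IsOrderedAddMonoid E] [Module ℝ E] [IsOrderedModule ℝ E]`. -/

section Operators

variable {E : Type u} [AddCommGroup E] [Lattice E] [IsOrderedAddMonoid E]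
  [Module ℝ E] [IsOrderedModule ℝ E]
variable {F : Type v} [AddCommGroup F] [Lattice F] [IsOrderedAddMonoid F]
  [Module ℝ F] [IsOrderedModule ℝ F]

/-- A linear operator between Riesz spaces is order bounded if it maps order intervals into
order intervals. -/
def IsOrderBoundedOp (T : E →ₗ[ℝ] F) : Prop :=
  ∀ a b : E, ∃ c d : F, ∀ x ∈ Set.Icc a b, T x ∈ Set.Icc c d

/-- Disjointness `x ⊥ y` of two elements of a Riesz space: `|x| ∧ |y| = 0`. -/
def RieszDisjoint (x y : E) : Prop := |x| ⊓ |y| = 0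

/-- An orthomorphism of a Riesz space: an order bounded linear operator `π` such that
`x ⊥ y` implies `π x ⊥ y`. -/
structure IsOrthomorphism (π : E →ₗ[ℝ] E) : Prop where
  orderBounded : IsOrderBoundedOp π
  disjoint : ∀ x y : E, RieszDisjoint x y → RieszDisjoint (π x) y

end Operators

/-! ## The order dual -/

section Dual

variable (E : Type u) [AddCommGroup E] [Lattice E] [IsOrderedAddMonoid E]
  [Module ℝ E] [IsOrderedModule ℝ E]

/-- The vector space of order bounded linear functionals on `E`. -/
def orderBoundedFunctionals : Submodule ℝ (E →ₗ[ℝ] ℝ) where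
  carrier := {f | IsOrderBoundedOp f}
  zero_mem' := fun _ _ => ⟨0, 0, fun _ _ => by simp⟩
  add_mem' := by
    intro f g hf hg a b
    obtain ⟨c, d, h⟩ := hf a b
    obtain ⟨c', d', h'⟩ := hg a b
    exact ⟨c + c', d + d', fun x hx =>
      ⟨add_le_add (h x hx).1 (h' x hx).1, add_le_add (h x hx).2 (h' x hx).2⟩⟩
  smul_mem' := by
    intro r f hf a b
    obtain ⟨c, d, h⟩ := hf a b
    rcases le_total 0 r with hr | hr
    · exact ⟨r * c, r * d, fun x hx =>
        ⟨mul_le_mul_of_nonneg_left (h x hx).1 hr, mul_le_mul_of_nonneg_left (h x hx).2 hr⟩⟩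
    · exact ⟨r * d, r * c, fun x hx =>
        ⟨mul_le_mul_of_nonpos_left (h x hx).2 hr, mul_le_mul_of_nonpos_left (h x hx).1 hr⟩⟩

/-- The order dual `E~` of a Riesz space: all order bounded linear functionals on `E`. -/
def RieszDual : Type u := orderBoundedFunctionals E

namespace RieszDual

instance : AddCommGroup (RieszDual E) := inferInstanceAs (AddCommGroup (orderBoundedFunctionals E))

instance : Module ℝ (RieszDual E) := inferInstanceAs (Module ℝ (orderBoundedFunctionals E))

variable {E}

/-- The linear functional underlying an element of the order dual. -/
def toLin (f : RieszDual E) : E →ₗ[ℝ] ℝ := f.1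

instance : CoeFun (RieszDual E) (fun _ => E → ℝ) := ⟨fun f => f.toLin⟩

/-- An order bounded linear functional as an element of the order dual. -/
def mk (f : E →ₗ[ℝ] ℝ) (hf : IsOrderBoundedOp f) : RieszDual E := ⟨f, hf⟩

theorem orderBounded (f : RieszDual E) : IsOrderBoundedOp f.toLin := f.2

@[simp] theorem mk_apply (f : E →ₗ[ℝ] ℝ) (hf : IsOrderBoundedOp f) (x : E) : mk f hf x = f x := rfl

@[simp] theorem zero_apply (x : E) : (0 : RieszDual E) x = 0 := rfl

@[simp] theorem add_apply (f g : RieszDual E) (x : E) : (f + g) x = f x + g x := rfl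

@[simp] theorem neg_apply (f : RieszDual E) (x : E) : (-f) x = -f x := rfl

@[simp] theorem sub_apply (f g : RieszDual E) (x : E) : (f - g) x = f x - g x := rfl

@[simp] theorem smul_apply (r : ℝ) (f : RieszDual E) (x : E) : (r • f) x = r * f x := rfl

theorem ext_fun {f g : RieszDual E} (h : ∀ x, f x = g x) : f = g :=
  Subtype.ext (LinearMap.ext h)

/-- The order of the order dual: `f ≤ g` iff `f x ≤ g x` for all `x ≥ 0`. -/
instance : PartialOrder (RieszDual E) where
  le f g := ∀ x : E, 0 ≤ x → f x ≤ g x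
  le_refl _ _ _ := le_rfl
  le_trans _ _ _ h h' x hx := (h x hx).trans (h' x hx)
  le_antisymm f g h h' := by
    apply ext_fun
    intro x
    have h1 := le_antisymm (h _ (posPart_nonneg x)) (h' _ (posPart_nonneg x))
    have h2 := le_antisymm (h _ (negPart_nonneg x)) (h' _ (negPart_nonneg x))
    have h3 : x = x⁺ - x⁻ := (posPart_sub_negPart x).symm
    rw [h3, map_sub, map_sub, h1, h2]

theorem le_def {f g : RieszDual E} : f ≤ g ↔ ∀ x : E, 0 ≤ x → f x ≤ g x := Iff.rfl

instance : IsOrderedAddMonoid (RieszDual E) where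
  add_le_add_left f g h k x hx := by
    simpa using h x hx

/-! The positive part of a functional, `f⁺(x) = sup {f y : 0 ≤ y ≤ x}` for `x ≥ 0`. -/

/-- `sup {f y : 0 ≤ y ≤ x}`. -/
noncomputable def supIcc (f : RieszDual E) (x : E) : ℝ := sSup (f.toLin '' Set.Icc 0 x)

theorem le_supIcc (f : RieszDual E) {x y : E} (hy : 0 ≤ y) (hyx : y ≤ x) : f y ≤ supIcc f x := by
  obtain ⟨c, d, h⟩ := f.orderBounded 0 x
  apply le_csSup
  · refine ⟨d, ?_⟩
    rintro _ ⟨z, hz, rfl⟩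
    exact (h z hz).2
  · exact ⟨y, ⟨hy, hyx⟩, rfl⟩

theorem supIcc_le (f : RieszDual E) {x : E} (hx : 0 ≤ x) {r : ℝ}
    (h : ∀ y, 0 ≤ y → y ≤ x → f y ≤ r) : supIcc f x ≤ r := by
  apply csSup_le
  · exact ⟨_, 0, ⟨le_rfl, hx⟩, rfl⟩
  · rintro _ ⟨z, hz, rfl⟩
    exact h z hz.1 hz.2

theorem supIcc_nonneg (f : RieszDual E) {x : E} (hx : 0 ≤ x) : 0 ≤ supIcc f x := by
  simpa using le_supIcc f le_rfl hx

theorem supIcc_add (f : RieszDual E) {x y : E} (hx : 0 ≤ x) (hy : 0 ≤ y) :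
    supIcc f (x + y) = supIcc f x + supIcc f y := by
  apply le_antisymm
  · apply supIcc_le f (add_nonneg hx hy)
    intro w hw hwxy
    have h1 : f (w ⊓ x) ≤ supIcc f x := le_supIcc f (le_inf hw hx) inf_le_right
    have h2 : f (w - w ⊓ x) ≤ supIcc f y := by
      apply le_supIcc f (sub_nonneg.2 inf_le_left)
      rw [sub_le_comm]
      apply le_inf
      · exact sub_le_self _ hy
      · exact sub_le_iff_le_add.2 hwxy
    rw [map_sub] at h2
    linarith
  · have h1 : supIcc f x ≤ supIcc f (x + y) - supIcc f y := by
      apply supIcc_le f hx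
      intro a ha hax
      have h2 : supIcc f y ≤ supIcc f (x + y) - f a := by
        apply supIcc_le f hy
        intro b hb hby
        have := le_supIcc f (add_nonneg ha hb) (add_le_add hax hby)
        rw [map_add] at this
        linarith
      linarith
    linarith

theorem supIcc_smul (f : RieszDual E) {r : ℝ} (hr : 0 ≤ r) {x : E} (hx : 0 ≤ x) :
    supIcc f (r • x) = r * supIcc f x := by
  have key : ∀ s : ℝ, 0 < s → ∀ y : E, 0 ≤ y → s * supIcc f y ≤ supIcc f (s • y) := by
    intro s hs y hy
    rw [mul_comm, ← le_div_iff₀ hs]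
    apply supIcc_le f hy
    intro z hz hzy
    rw [le_div_iff₀ hs, mul_comm]
    have := le_supIcc f (smul_nonneg hs.le hz) (smul_le_smul_of_nonneg_left hzy hs.le)
    simpa using this
  rcases hr.eq_or_lt with rfl | hr
  · rw [zero_smul, zero_mul]
    apply le_antisymm _ (supIcc_nonneg f le_rfl)
    apply supIcc_le f le_rfl
    intro y h1 h2
    rw [le_antisymm h2 h1, map_zero]
  · apply le_antisymm _ (key r hr x hx)
    have := key r⁻¹ (inv_pos.2 hr) (r • x) (smul_nonneg hr.le hx)
    rw [inv_smul_smul₀ hr.ne'] at this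
    rwa [inv_mul_le_iff₀ hr] at this

theorem supIcc_sub (f : RieszDual E) {a b c d : E} (ha : 0 ≤ a) (hb : 0 ≤ b) (hc : 0 ≤ c)
    (hd : 0 ≤ d) (h : a - b = c - d) : supIcc f a - supIcc f b = supIcc f c - supIcc f d := by
  have h1 : a + d = c + b := by
    rw [sub_eq_sub_iff_add_eq_add] at h
    exact h
  have h2 := supIcc_add f ha hd
  rw [h1, supIcc_add f hc hb] at h2
  linarith

/-- The positive part as a linear functional. -/
noncomputable def posLin (f : RieszDual E) : E →ₗ[ℝ] ℝ where
  toFun x := supIcc f x⁺ - supIcc f x⁻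
  map_add' x y := by
    have h := supIcc_sub f (posPart_nonneg (x + y)) (negPart_nonneg (x + y))
      (add_nonneg (posPart_nonneg x) (posPart_nonneg y))
      (add_nonneg (negPart_nonneg x) (negPart_nonneg y))
      (by rw [posPart_sub_negPart, add_sub_add_comm, posPart_sub_negPart, posPart_sub_negPart])
    rw [h, supIcc_add f (posPart_nonneg x) (posPart_nonneg y),
      supIcc_add f (negPart_nonneg x) (negPart_nonneg y)]
    ring
  map_smul' r x := by
    have hp := posPart_nonneg x
    have hn := negPart_nonneg x
    rcases le_total 0 r with hr | hr
    · have h := supIcc_sub f (posPart_nonneg (r • x)) (negPart_nonneg (r • x))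
        (smul_nonneg hr hp) (smul_nonneg hr hn)
        (by rw [posPart_sub_negPart, ← smul_sub, posPart_sub_negPart])
      rw [h, supIcc_smul f hr hp, supIcc_smul f hr hn]
      simp [mul_sub]
    · have hr' : 0 ≤ -r := neg_nonneg.2 hr
      have h := supIcc_sub f (posPart_nonneg (r • x)) (negPart_nonneg (r • x))
        (smul_nonneg hr' hn) (smul_nonneg hr' hp)
        (by
          rw [posPart_sub_negPart, ← smul_sub, neg_smul, ← smul_neg, neg_sub,
            posPart_sub_negPart])
      rw [h, supIcc_smul f hr' hp, supIcc_smul f hr' hn]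
      simp only [RingHom.id_apply, smul_eq_mul]
      ring

theorem posLin_apply (f : RieszDual E) {x : E} (hx : 0 ≤ x) : posLin f x = supIcc f x := by
  have h := supIcc_sub f (posPart_nonneg x) (negPart_nonneg x) hx le_rfl
    (by rw [posPart_sub_negPart, sub_zero])
  have h0 := supIcc_add f (le_refl (0 : E)) (le_refl (0 : E))
  rw [add_zero] at h0
  change supIcc f x⁺ - supIcc f x⁻ = _
  linarith

/-- A positive linear functional is order bounded. -/
theorem isOrderBoundedOp_of_nonneg (f : E →ₗ[ℝ] ℝ) (hf : ∀ x, 0 ≤ x → 0 ≤ f x) :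
    IsOrderBoundedOp f := by
  intro a b
  refine ⟨f a, f b, fun x hx => ⟨?_, ?_⟩⟩
  · have := hf _ (sub_nonneg.2 hx.1)
    rw [map_sub] at this
    linarith
  · have := hf _ (sub_nonneg.2 hx.2)
    rw [map_sub] at this
    linarith

/-- The positive part as an element of the order dual. -/
noncomputable def pos (f : RieszDual E) : RieszDual E :=
  mk (posLin f) (isOrderBoundedOp_of_nonneg _ fun x hx => by
    rw [posLin_apply f hx]
    exact supIcc_nonneg f hx)

theorem pos_apply (f : RieszDual E) {x : E} (hx : 0 ≤ x) : pos f x = supIcc f x :=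
  posLin_apply f hx

theorem le_pos (f : RieszDual E) : f ≤ pos f := fun x hx => by
  rw [pos_apply f hx]
  exact le_supIcc f hx le_rfl

theorem zero_le_pos (f : RieszDual E) : 0 ≤ pos f := fun x hx => by
  rw [pos_apply f hx]
  exact supIcc_nonneg f hx

theorem pos_le {f g : RieszDual E} (h : f ≤ g) (h0 : 0 ≤ g) : pos f ≤ g := fun x hx => by
  rw [pos_apply f hx]
  apply supIcc_le f hx
  intro y hy hyx
  have h1 := h0 _ (sub_nonneg.2 hyx)
  rw [zero_apply, map_sub] at h1
  have h2 := h y hy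
  linarith

/-- The lattice structure of the order dual; it is determined by the order. -/
noncomputable instance : Lattice (RieszDual E) where
  sup f g := g + pos (f - g)
  inf f g := f - pos (f - g)
  le_sup_left f g := sub_le_iff_le_add'.1 (le_pos (f - g))
  le_sup_right f g := le_add_of_nonneg_right (zero_le_pos (f - g))
  sup_le f g k hf hg := by
    have : pos (f - g) ≤ k - g := pos_le (sub_le_sub_right hf g) (sub_nonneg.2 hg)
    exact le_sub_iff_add_le'.1 this
  inf_le_left f g := sub_le_self _ (zero_le_pos (f - g))
  inf_le_right f g := sub_le_comm.1 (le_pos (f - g))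
  le_inf k f g hf hg := by
    have : pos (f - g) ≤ f - k := pos_le (sub_le_sub_left hg f) (sub_nonneg.2 hf)
    exact le_sub_comm.1 this

instance : IsOrderedModule ℝ (RieszDual E) where
  smul_le_smul_of_nonneg_left r hr f g h x hx := by
    simpa using mul_le_mul_of_nonneg_left (h x hx) hr
  smul_le_smul_of_nonneg_right f hf r s h x hx := by
    simpa using mul_le_mul_of_nonneg_right h (hf x hx)

end RieszDual

/-- Order continuity of a functional: `f (x i) → 0` for every net `x` that converges in order to
`0`, that is, for which there is a net `y` decreasing to `0` with `|x i| ≤ y i` for all `i`. -/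
def IsOrderContinuous {E : Type u} [AddCommGroup E] [Lattice E] [IsOrderedAddMonoid E]
    [Module ℝ E] [IsOrderedModule ℝ E] (f : RieszDual E) : Prop :=
  ∀ (ι : Type u) [Preorder ι] [IsDirectedOrder ι] [Nonempty ι] (x y : ι → E),
    Antitone y → IsGLB (Set.range y) 0 → (∀ i, |x i| ≤ y i) →
    Tendsto (fun i => f (x i)) atTop (𝓝 0)

/-- The order continuous part `E~_n` of the order dual. -/
def orderContinuousDual : Submodule ℝ (RieszDual E) where
  carrier := {f | IsOrderContinuous f}
  zero_mem' := fun _ _ _ _ _ _ _ _ _ => tendsto_const_nhds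
  add_mem' := by
    intro f g hf hg ι _ _ _ x y h1 h2 h3
    simpa using (hf ι x y h1 h2 h3).add (hg ι x y h1 h2 h3)
  smul_mem' := by
    intro r f hf ι _ _ _ x y h1 h2 h3
    simpa using (hf ι x y h1 h2 h3).const_mul r

/-- The order dual of `E` separates the points of `E`. -/
def HasSeparatingOrderDual : Prop := ∀ x : E, (∀ f : RieszDual E, f x = 0) → x = 0

end Dual

/-! ## f-algebras and the Arens products -/

section FAlgebra

/-- An f-algebra: a Riesz space with an associative bilinear multiplication (no unit and no
commutativity are required) such that products of positive elements are positive and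
`a ∧ b = 0`, `c ≥ 0` imply `(c * a) ∧ b = (a * c) ∧ b = 0`. -/
class IsFAlgebra (A : Type u) [NonUnitalRing A] [Lattice A] [IsOrderedAddMonoid A] [Module ℝ A]
    [IsOrderedModule ℝ A] [IsScalarTower ℝ A A] [SMulCommClass ℝ A A] : Prop where
  mul_nonneg : ∀ a b : A, 0 ≤ a → 0 ≤ b → 0 ≤ a * b
  mul_left_inf : ∀ a b c : A, a ⊓ b = 0 → 0 ≤ c → (c * a) ⊓ b = 0
  mul_right_inf : ∀ a b c : A, a ⊓ b = 0 → 0 ≤ c → (a * c) ⊓ b = 0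

variable {A : Type u} [NonUnitalRing A] [Lattice A] [IsOrderedAddMonoid A] [Module ℝ A]
  [IsOrderedModule ℝ A] [IsScalarTower ℝ A A] [SMulCommClass ℝ A A] [IsFAlgebra A]

theorem IsFAlgebra.mul_le_mul_left' {a b c : A} (h : a ≤ b) (hc : 0 ≤ c) : c * a ≤ c * b := by
  have := IsFAlgebra.mul_nonneg c (b - a) hc (sub_nonneg.2 h)
  rwa [mul_sub, sub_nonneg] at this

theorem IsFAlgebra.mul_le_mul_right' {a b c : A} (h : a ≤ b) (hc : 0 ≤ c) : a * c ≤ b * c := by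
  have := IsFAlgebra.mul_nonneg (b - a) c (sub_nonneg.2 h) hc
  rwa [sub_mul, sub_nonneg] at this

/-- The product `f · a` of `f ∈ A~` and `a ∈ A`: `(f · a) b = f (a * b)`. -/
def dualMul (f : RieszDual A) (a : A) : RieszDual A :=
  RieszDual.mk (f.toLin ∘ₗ LinearMap.mulLeft ℝ a) (by
    intro x y
    obtain ⟨c, d, h⟩ := f.orderBounded (a⁺ * x - a⁻ * y) (a⁺ * y - a⁻ * x)
    refine ⟨c, d, fun b hb => h _ ?_⟩
    have e : a * b = a⁺ * b - a⁻ * b := by rw [← sub_mul, posPart_sub_negPart]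
    rw [LinearMap.mulLeft_apply, e]
    exact ⟨sub_le_sub (IsFAlgebra.mul_le_mul_left' hb.1 (posPart_nonneg a))
        (IsFAlgebra.mul_le_mul_left' hb.2 (negPart_nonneg a)),
      sub_le_sub (IsFAlgebra.mul_le_mul_left' hb.2 (posPart_nonneg a))
        (IsFAlgebra.mul_le_mul_left' hb.1 (negPart_nonneg a))⟩)

@[simp] theorem dualMul_apply (f : RieszDual A) (a b : A) : dualMul f a b = f (a * b) := rfl

theorem dualMul_mono {f : RieszDual A} (hf : 0 ≤ f) {a b : A} (h : a ≤ b) :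
    dualMul f a ≤ dualMul f b := by
  intro x hx
  have := hf _ (sub_nonneg.2 (IsFAlgebra.mul_le_mul_right' h hx))
  rw [RieszDual.zero_apply, map_sub, sub_nonneg] at this
  simpa using this

/-- The product `F · f` of `F ∈ (A~)~` and `f ∈ A~`: `(F · f) a = F (f · a)`. -/
noncomputable def bidualMul (F : RieszDual (RieszDual A)) (f : RieszDual A) : RieszDual A :=
  RieszDual.mk
    { toFun := fun a => F (dualMul f a)
      map_add' := fun a b => by
        rw [← map_add]
        congr 1
        apply RieszDual.ext_fun
        intro x
        simp [add_mul]
      map_smul' := fun r a => by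
        rw [RingHom.id_apply, ← map_smul]
        congr 1
        apply RieszDual.ext_fun
        intro x
        simp [smul_mul_assoc] }
    (by
      intro x y
      obtain ⟨c, d, h⟩ := F.orderBounded (dualMul f⁺ x - dualMul f⁻ y) (dualMul f⁺ y - dualMul f⁻ x)
      refine ⟨c, d, fun a ha => h _ ?_⟩
      have e : dualMul f a = dualMul f⁺ a - dualMul f⁻ a := by
        apply RieszDual.ext_fun
        intro z
        rw [RieszDual.sub_apply, dualMul_apply, dualMul_apply, dualMul_apply,
          ← RieszDual.sub_apply, posPart_sub_negPart]
      rw [e]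
      exact ⟨sub_le_sub (dualMul_mono (posPart_nonneg f) ha.1)
          (dualMul_mono (negPart_nonneg f) ha.2),
        sub_le_sub (dualMul_mono (posPart_nonneg f) ha.2)
          (dualMul_mono (negPart_nonneg f) ha.1)⟩)

@[simp] theorem bidualMul_apply (F : RieszDual (RieszDual A)) (f : RieszDual A) (a : A) :
    bidualMul F f a = F (dualMul f a) := rfl

/-- An operator `T` on `A~` is f-linear with respect to `(A~)~_n` if it is linear, order bounded
and `T (G · f) = G · T f` for all `G ∈ (A~)~_n` and `f ∈ A~`. -/
structure IsFLinear (T : RieszDual A →ₗ[ℝ] RieszDual A) : Prop where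
  orderBounded : IsOrderBoundedOp T
  map_bidualMul : ∀ G ∈ orderContinuousDual (RieszDual A), ∀ f : RieszDual A,
    T (bidualMul G f) = bidualMul G (T f)

end FAlgebra

/-!
Orthomorphisms of an Archimedean Riesz space commute, and the order dual is Archimedean, so it
suffices that `f ↦ G · f` is an orthomorphism whenever `G` is order continuous.

If `f ∧ g = 0` in the order dual and `b ≥ 0`, there are `0 ≤ xₙ ≤ b` with `f xₙ ≤ 4⁻ⁿ` and
`g (b - xₙ) ≤ 4⁻ⁿ`. Right multiplication by `c ≥ 0` is a positive orthomorphism of the algebra,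
which gives `k (x c) ≤ k² x + x c c` and hence, for `k = 2ⁿ`,
`(f · xₙ) c ≤ 2⁻ⁿ (1 + f (b c c))`. So the functionals `f · xₙ` are summable, their tails decrease
to `0`, and order continuity of `G` makes `|G · f| xₙ` tend to `0`: thus `|G · f| ∧ g = 0`.

For the commutation of positive orthomorphisms `S` and `T`, the two elements `S T x` and `T S x`
lie on the same side of `t • T x` at every level `t ≥ 0`; levels `0, ε, 2ε, …` then pin their
difference down to `ε • T x`, up to a remainder that the inequality above makes small.
-/

section LatticeGroup

variable {E : Type u} [AddCommGroup E] [Lattice E] [IsOrderedAddMonoid E]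

theorem posPart_le_abs (x : E) : x⁺ ≤ |x| := sup_le (le_abs_self x) (abs_nonneg x)

theorem negPart_le_abs (x : E) : x⁻ ≤ |x| := sup_le (neg_le_abs x) (abs_nonneg x)

theorem negPart_sub_le_negPart_add (u : E) {x : E} (hx : 0 ≤ x) : (u - x)⁻ ≤ u⁻ + x := by
  refine sup_le ?_ (add_nonneg (negPart_nonneg u) hx)
  rw [neg_sub', sub_neg_eq_add]
  gcongr
  exact neg_le_negPart u

theorem inf_add_le_inf_add_inf {a b c : E} (ha : 0 ≤ a) (hb : 0 ≤ b) (hc : 0 ≤ c) :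
    a ⊓ (b + c) ≤ a ⊓ b + a ⊓ c := by
  rw [add_inf, inf_add, inf_add]
  refine le_inf (le_inf ?_ ?_) (le_inf ?_ inf_le_right)
  · exact inf_le_left.trans (le_add_of_nonneg_left ha)
  · exact inf_le_left.trans (le_add_of_nonneg_left hb)
  · exact inf_le_left.trans (le_add_of_nonneg_right hc)

omit [IsOrderedAddMonoid E] in
theorem inf_eq_zero_of_le_of_le {a a' b b' : E} (h : a ⊓ b = 0) (ha₀ : 0 ≤ a') (ha : a' ≤ a)
    (hb₀ : 0 ≤ b') (hb : b' ≤ b) : a' ⊓ b' = 0 :=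
  le_antisymm ((inf_le_inf ha hb).trans h.le) (le_inf ha₀ hb₀)

theorem inf_add_eq_zero {a b c : E} (hb : a ⊓ b = 0) (hc : a ⊓ c = 0) : a ⊓ (b + c) = 0 := by
  have ha₀ : 0 ≤ a := hb ▸ inf_le_left
  have hb₀ : 0 ≤ b := hb ▸ inf_le_right
  have hc₀ : 0 ≤ c := hc ▸ inf_le_right
  refine le_antisymm ?_ (le_inf ha₀ (add_nonneg hb₀ hc₀))
  simpa only [hb, hc, add_zero] using inf_add_le_inf_add_inf ha₀ hb₀ hc₀

theorem add_inf_eq_zero {a b c : E} (ha : a ⊓ c = 0) (hb : b ⊓ c = 0) : (a + b) ⊓ c = 0 := by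
  rw [inf_comm] at ha hb ⊢
  exact inf_add_eq_zero ha hb

theorem le_of_le_add_of_inf_eq_zero {a b c : E} (h : a ≤ b + c) (hb : 0 ≤ b) (hac : a ⊓ c = 0) :
    a ≤ b := by
  have ha : 0 ≤ a := hac ▸ inf_le_left
  have hc : 0 ≤ c := hac ▸ inf_le_right
  calc a ≤ a ⊓ (b + c) := le_inf le_rfl h
    _ ≤ a ⊓ b + a ⊓ c := inf_add_le_inf_add_inf ha hb hc
    _ ≤ b := by rw [hac, add_zero]; exact inf_le_right

theorem posPart_sub_of_inf_eq_zero {a b : E} (h : a ⊓ b = 0) : (a - b)⁺ = a := by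
  rw [inf_eq_sub_posPart_sub, sub_eq_zero] at h
  exact h.symm

/-- Think of real functions: at each point, as long as `a` has not vanished `z ≤ a i`, and at the
first index where it has, `b` has grown by one step from `0`, so that `z ≤ b ≤ δ` there. -/
theorem le_sup_of_inf_eq_zero_of_le_add {z δ : E} {a b : ℕ → E} (hz : ∀ i, z ≤ a i + b i)
    (hab : ∀ i, a i ⊓ b i = 0) (hb₀ : b 0 = 0) (hb : ∀ i, b (i + 1) ≤ b i + δ) (i : ℕ) :
    z ≤ δ ⊔ a i := by
  let : DistribLattice E := AddCommGroup.toDistribLattice E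
  have ha_nonneg (i) : 0 ≤ a i := hab i ▸ inf_le_left
  have hb_nonneg (i) : 0 ≤ b i := hab i ▸ inf_le_right
  have hδ : 0 ≤ δ := by simpa [hb₀] using (hb_nonneg 1).trans (hb 0)
  have hz_sup (i) : z ≤ a i ⊔ b i := by
    rw [← zero_add (a i ⊔ b i), ← hab i, inf_add_sup]
    exact hz i
  induction i with
  | zero => simpa [hb₀] using (hz 0).trans le_sup_right
  | succ k ih =>
    have hstep : a k ⊓ b (k + 1) ≤ δ :=
      calc a k ⊓ b (k + 1) ≤ a k ⊓ (b k + δ) := inf_le_inf_left _ (hb k)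
        _ ≤ a k ⊓ b k + a k ⊓ δ := inf_add_le_inf_add_inf (ha_nonneg k) (hb_nonneg k) hδ
        _ ≤ δ := by rw [hab, zero_add]; exact inf_le_right
    calc z ≤ (δ ⊔ a k) ⊓ (a (k + 1) ⊔ b (k + 1)) := le_inf ih (hz_sup (k + 1))
      _ = δ ⊓ (a (k + 1) ⊔ b (k + 1)) ⊔ (a k ⊓ a (k + 1) ⊔ a k ⊓ b (k + 1)) := by
        rw [inf_sup_right, inf_sup_left (a k)]
      _ ≤ δ ⊔ a (k + 1) := sup_le (inf_le_left.trans le_sup_left)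
        (sup_le (inf_le_right.trans le_sup_right) (hstep.trans le_sup_left))

end LatticeGroup

namespace IsOrderBoundedOp

variable {E : Type u} [AddCommGroup E] [Lattice E] [Module ℝ E]
  {F : Type v} [AddCommGroup F] [Lattice F] [Module ℝ F]

theorem of_monotone {T : E →ₗ[ℝ] F} (hT : Monotone T) : IsOrderBoundedOp T :=
  fun a b => ⟨T a, T b, fun _ hx => ⟨hT hx.1, hT hx.2⟩⟩

theorem sub [IsOrderedAddMonoid F] {S T : E →ₗ[ℝ] F} (hS : IsOrderBoundedOp S)
    (hT : IsOrderBoundedOp T) : IsOrderBoundedOp (S - T) := fun a b => by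
  obtain ⟨c, d, hcd⟩ := hS a b
  obtain ⟨c', d', hcd'⟩ := hT a b
  exact ⟨c - d', d - c', fun x hx =>
    ⟨sub_le_sub (hcd x hx).1 (hcd' x hx).2, sub_le_sub (hcd x hx).2 (hcd' x hx).1⟩⟩

theorem exists_abs_le_smul [IsOrderedModule ℝ E] [IsOrderedAddMonoid F] [IsOrderedModule ℝ F]
    {T : E →ₗ[ℝ] F} (hT : IsOrderBoundedOp T) (x : E) :
    ∃ h : F, ∀ ε : ℝ, 0 < ε → ∀ u, 0 ≤ u → u ≤ ε • x → |T u| ≤ ε • h := by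
  obtain ⟨c, d, hcd⟩ := hT 0 x
  refine ⟨d ⊔ -c, fun ε hε u hu hux => ?_⟩
  have hTu := hcd (ε⁻¹ • u) ⟨smul_nonneg (inv_pos.2 hε).le hu, (inv_smul_le_iff_of_pos hε).2 hux⟩
  rw [map_smul] at hTu
  refine sup_le ?_ ?_
  · exact ((inv_smul_le_iff_of_pos hε).1 hTu.2).trans
      (smul_le_smul_of_nonneg_left le_sup_left hε.le)
  · rw [← inv_smul_le_iff_of_pos hε, smul_neg]
    exact (neg_le_neg hTu.1).trans le_sup_right

end IsOrderBoundedOp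

section Riesz

variable {E : Type u} [AddCommGroup E] [Lattice E] [IsOrderedAddMonoid E] [Module ℝ E]

/-- An Archimedean Riesz space, in the form needed to let `ε` tend to `0`:
`x ≤ 0` as soon as `x ≤ ε • y` for all `ε > 0`. -/
def IsArchimedeanRiesz (E : Type u) [AddCommGroup E] [Lattice E] [Module ℝ E] : Prop :=
  ∀ x y : E, (∀ ε : ℝ, 0 < ε → x ≤ ε • y) → x ≤ 0

theorem linearMap_ext_of_nonneg {F : Type v} [AddCommGroup F] [Module ℝ F] {S T : E →ₗ[ℝ] F}
    (h : ∀ x, 0 ≤ x → S x = T x) : S = T := by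
  ext x
  rw [← posPart_sub_negPart x, map_sub, map_sub, h _ (posPart_nonneg x), h _ (negPart_nonneg x)]

theorem negPart_apply_le (π : E →ₗ[ℝ] E) (v y : E) (i : ℕ) :
    (π y)⁻ ≤ |π (y - i • v)⁺| + |π (y - i • v)⁻| + i • (π v)⁻ := by
  refine sup_le ?_ (by positivity)
  calc -π y = -π (y - i • v)⁺ + π (y - i • v)⁻ + i • -π v := by
        have hy : y = (y - i • v)⁺ - (y - i • v)⁻ + i • v := by
          rw [posPart_sub_negPart, sub_add_cancel]
        conv_lhs => rw [hy, map_add, map_sub, map_nsmul]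
        rw [smul_neg]
        abel
    _ ≤ _ := by
        gcongr
        · exact neg_le_abs _
        · exact le_abs_self _
        · exact neg_le_negPart _

namespace IsOrthomorphism

variable {π S T : E →ₗ[ℝ] E}

theorem abs_apply_inf_eq_zero (hπ : IsOrthomorphism π) {x y : E} (h : x ⊓ y = 0) :
    |π x| ⊓ y = 0 := by
  have hx : 0 ≤ x := h ▸ inf_le_left
  have hy : 0 ≤ y := h ▸ inf_le_right
  have := hπ.disjoint x y (by rwa [RieszDisjoint, abs_of_nonneg hx, abs_of_nonneg hy])
  rwa [RieszDisjoint, abs_of_nonneg hy] at this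

theorem abs_apply_inf_abs_apply_eq_zero (hπ : IsOrthomorphism π) {x y : E} (h : x ⊓ y = 0) :
    |π x| ⊓ |π y| = 0 := by
  have hxy := hπ.abs_apply_inf_eq_zero h
  rw [inf_comm] at hxy ⊢
  exact hπ.abs_apply_inf_eq_zero hxy

theorem apply_inf_eq_zero (hπ : IsOrthomorphism π) (hπ_mono : Monotone π) {x y : E}
    (h : x ⊓ y = 0) : π x ⊓ y = 0 := by
  have hx : 0 ≤ x := h ▸ inf_le_left
  have hπx : 0 ≤ π x := by simpa using hπ_mono hx
  simpa only [abs_of_nonneg hπx] using hπ.abs_apply_inf_eq_zero h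

theorem of_abs_apply_inf_eq_zero (hπ : IsOrderBoundedOp π)
    (h : ∀ x y, x ⊓ y = 0 → |π x| ⊓ y = 0) : IsOrthomorphism π where
  orderBounded := hπ
  disjoint x y hxy := by
    have hpos : |π x⁺| ⊓ |y| = 0 := h _ _ <|
      inf_eq_zero_of_le_of_le hxy (posPart_nonneg x) (posPart_le_abs x) (abs_nonneg y) le_rfl
    have hneg : |π x⁻| ⊓ |y| = 0 := h _ _ <|
      inf_eq_zero_of_le_of_le hxy (negPart_nonneg x) (negPart_le_abs x) (abs_nonneg y) le_rfl
    refine inf_eq_zero_of_le_of_le (add_inf_eq_zero hpos hneg) (abs_nonneg _) ?_ (abs_nonneg _)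
      le_rfl
    calc |π x| = |π x⁺ + -π x⁻| := by rw [← sub_eq_add_neg, ← map_sub, posPart_sub_negPart]
      _ ≤ |π x⁺| + |π x⁻| := by simpa only [abs_neg] using abs_add_le (π x⁺) (-π x⁻)

theorem of_monotone (hπ : Monotone π) (h : ∀ x y, x ⊓ y = 0 → π x ⊓ y = 0) :
    IsOrthomorphism π :=
  of_abs_apply_inf_eq_zero (.of_monotone hπ) fun x y hxy => by
    have hx : 0 ≤ x := hxy ▸ inf_le_left
    have hπx : 0 ≤ π x := by simpa using hπ hx
    rw [abs_of_nonneg hπx, h x y hxy]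

theorem sub (hS : IsOrthomorphism S) (hT : IsOrthomorphism T) : IsOrthomorphism (S - T) :=
  of_abs_apply_inf_eq_zero (hS.orderBounded.sub hT.orderBounded) fun x y h => by
    refine inf_eq_zero_of_le_of_le
      (add_inf_eq_zero (hS.abs_apply_inf_eq_zero h) (hT.abs_apply_inf_eq_zero h))
      (abs_nonneg _) ?_ (h ▸ inf_le_right) le_rfl
    rw [LinearMap.sub_apply, sub_eq_add_neg, ← abs_neg (T x)]
    exact abs_add_le (S x) (-T x)

end IsOrthomorphism

variable [IsOrderedModule ℝ E]

omit [IsOrderedAddMonoid E] in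
theorem posPart_smul_of_nonneg {r : ℝ} (hr : 0 ≤ r) (x : E) : (r • x)⁺ = r • x⁺ := by
  rcases hr.eq_or_lt with rfl | hr
  · simp
  · calc (r • x)⁺ = r • x ⊔ r • (0 : E) := by rw [smul_zero, posPart_def]
      _ = r • x⁺ := ((OrderIso.smulRight hr).map_sup x 0).symm

theorem smul_inf_eq_zero {a b : E} (h : a ⊓ b = 0) {r : ℝ} (hr : 0 ≤ r) : r • a ⊓ b = 0 := by
  have ha : 0 ≤ a := h ▸ inf_le_left
  have hb : 0 ≤ b := h ▸ inf_le_right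
  have hm : 0 < max r 1 := lt_max_of_lt_right one_pos
  have hmax : max r 1 • a ⊓ max r 1 • b = 0 := by
    rw [← smul_zero (max r 1), ← h]
    exact ((OrderIso.smulRight hm).map_inf a b).symm
  refine inf_eq_zero_of_le_of_le hmax (smul_nonneg hr ha) ?_ hb ?_
  · exact smul_le_smul_of_nonneg_right (le_max_left r 1) ha
  · simpa using smul_le_smul_of_nonneg_right (le_max_right r 1) hb

theorem exists_linearMap_eq_of_nonneg {F : Type v} [AddCommGroup F] [Module ℝ F] (φ : E → F)
    (hadd : ∀ x y, 0 ≤ x → 0 ≤ y → φ (x + y) = φ x + φ y)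
    (hsmul : ∀ (r : ℝ) (x), 0 ≤ r → 0 ≤ x → φ (r • x) = r • φ x) :
    ∃ T : E →ₗ[ℝ] F, ∀ x, 0 ≤ x → T x = φ x := by
  let ψ (x : E) : F := φ x⁺ - φ x⁻
  have hψ {a b : E} (ha : 0 ≤ a) (hb : 0 ≤ b) : ψ (a - b) = φ a - φ b := by
    rw [sub_eq_sub_iff_add_eq_add, ← hadd _ _ (posPart_nonneg _) hb,
      ← hadd _ _ ha (negPart_nonneg _), ← sub_eq_sub_iff_add_eq_add.1 (posPart_sub_negPart (a - b))]
  have hψ_add (x y : E) : ψ (x + y) = ψ x + ψ y := by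
    have hxy : x + y = x⁺ + y⁺ - (x⁻ + y⁻) := by
      rw [add_sub_add_comm, posPart_sub_negPart, posPart_sub_negPart]
    rw [hxy, hψ (add_nonneg (posPart_nonneg x) (posPart_nonneg y))
      (add_nonneg (negPart_nonneg x) (negPart_nonneg y)),
      hadd _ _ (posPart_nonneg x) (posPart_nonneg y),
      hadd _ _ (negPart_nonneg x) (negPart_nonneg y), add_sub_add_comm]
  have hψ_smul_nonneg {r : ℝ} (hr : 0 ≤ r) (x : E) : ψ (r • x) = r • ψ x := by
    have hx : r • x = r • x⁺ - r • x⁻ := by rw [← smul_sub, posPart_sub_negPart]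
    rw [hx, hψ (smul_nonneg hr (posPart_nonneg x)) (smul_nonneg hr (negPart_nonneg x)),
      hsmul _ _ hr (posPart_nonneg x), hsmul _ _ hr (negPart_nonneg x), smul_sub]
  have hψ_neg (x : E) : ψ (-x) = -ψ x := by
    simp only [ψ, posPart_neg, negPart_neg, neg_sub]
  refine ⟨⟨⟨ψ, hψ_add⟩, fun r x => ?_⟩, fun x hx => ?_⟩
  · rcases le_total 0 r with hr | hr
    · exact hψ_smul_nonneg hr x
    · have := hψ_smul_nonneg (neg_nonneg.2 hr) (-x)
      rwa [neg_smul_neg, hψ_neg, neg_smul_neg] at this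
  · have hφ₀ : φ 0 = 0 := by simpa using hsmul 0 0 le_rfl le_rfl
    simpa [hφ₀] using hψ hx le_rfl

namespace IsOrthomorphism

variable {π S T : E →ₗ[ℝ] E}

theorem smul_id {r : ℝ} (hr : 0 ≤ r) : IsOrthomorphism (r • LinearMap.id : E →ₗ[ℝ] E) :=
  of_monotone (fun _ _ hxy => smul_le_smul_of_nonneg_left hxy hr)
    fun _ _ h => smul_inf_eq_zero h hr

theorem neg (hπ : IsOrthomorphism π) : IsOrthomorphism (-π) := by
  simpa only [zero_smul, zero_sub] using (smul_id le_rfl).sub hπ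

/-- Where `S` acts as multiplication by `s`, this is `k * s ≤ k ^ 2 + s ^ 2`. -/
theorem smul_apply_le (hS : IsOrthomorphism S) (hS_mono : Monotone S) {x : E} (hx : 0 ≤ x)
    {k : ℝ} (hk : 0 ≤ k) : k • S x ≤ k ^ 2 • x + S (S x) := by
  have hS_nonneg {y : E} (hy : 0 ≤ y) : 0 ≤ S y := by simpa using hS_mono hy
  set u := S x - k • x with hu
  have hu_neg : u⁻ ≤ k • x := by
    refine sup_le ?_ (smul_nonneg hk hx)
    rw [hu, neg_sub]
    exact sub_le_self _ (hS_nonneg hx)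
  have hdisj : S u⁻ ⊓ k • u⁺ = 0 := by
    rw [inf_comm]
    refine smul_inf_eq_zero ?_ hk
    rw [inf_comm]
    exact hS.apply_inf_eq_zero hS_mono ((inf_comm _ _).trans (posPart_inf_negPart_eq_zero u))
  have hSu_neg : S u⁻ ≤ k ^ 2 • x := by
    refine le_of_le_add_of_inf_eq_zero ?_ (smul_nonneg (sq_nonneg k) hx) hdisj
    calc S u⁻ ≤ S (k • x) := hS_mono hu_neg
      _ = k ^ 2 • x + k • u := by rw [hu, map_smul, smul_sub, smul_smul, ← sq]; abel
      _ ≤ k ^ 2 • x + k • u⁺ := by gcongr; exact le_posPart u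
  calc k • S x = S u⁻ + S (S x) - S u⁺ := by
        have hSu : S u⁺ - S u⁻ = S (S x) - k • S x := by
          rw [← map_sub, posPart_sub_negPart, hu, map_sub, map_smul]
        rw [← sub_sub_cancel (S (S x)) (k • S x), ← hSu]
        abel
    _ ≤ S u⁻ + S (S x) := sub_le_self _ (hS_nonneg (posPart_nonneg u))
    _ ≤ k ^ 2 • x + S (S x) := by gcongr

/-- Along `u = y, y - v, …, y - n • v`, the element `|π u⁻|` grows from `0` in steps of at most `δ`,
while the disjoint element `|π u⁺|` ends at `0`. -/
theorem inf_negPart_apply_le (hπ : IsOrthomorphism π) {w v y δ : E} {n : ℕ} (hv : 0 ≤ v)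
    (hδ : ∀ u, 0 ≤ u → u ≤ v → |π u| ≤ δ) (hw : w ⊓ (π v)⁻ = 0) (hy : 0 ≤ y)
    (hyn : y ≤ n • v) : w ⊓ (π y)⁻ ≤ δ := by
  have hw₀ : 0 ≤ w := hw ▸ inf_le_left
  let u (i : ℕ) : E := y - i • v
  have hu_succ (i : ℕ) : u (i + 1) = u i - v := by
    simp only [u, succ_nsmul, sub_sub]
  have hsum (i : ℕ) : w ⊓ (π y)⁻ ≤ |π (u i)⁺| + |π (u i)⁻| := by
    have hdisj : w ⊓ i • (π v)⁻ = 0 := by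
      rw [← Nat.cast_smul_eq_nsmul ℝ, inf_comm]
      exact smul_inf_eq_zero ((inf_comm _ _).trans hw) i.cast_nonneg
    exact le_of_le_add_of_inf_eq_zero (inf_le_right.trans (negPart_apply_le π v y i))
      (by positivity)
      (inf_eq_zero_of_le_of_le hdisj (le_inf hw₀ (negPart_nonneg _)) inf_le_left
        (nsmul_nonneg (negPart_nonneg _) i) le_rfl)
  have hstep (i : ℕ) : |π (u (i + 1))⁻| ≤ |π (u i)⁻| + δ := by
    have hle : (u i)⁻ ≤ (u (i + 1))⁻ := negPart_anti (hu_succ i ▸ sub_le_self _ hv)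
    have hdiff : |π ((u (i + 1))⁻ - (u i)⁻)| ≤ δ :=
      hδ _ (sub_nonneg.2 hle)
        (sub_le_iff_le_add'.2 (hu_succ i ▸ negPart_sub_le_negPart_add (u i) hv))
    calc |π (u (i + 1))⁻| = |π (u i)⁻ + π ((u (i + 1))⁻ - (u i)⁻)| := by
          rw [← map_add, add_sub_cancel]
      _ ≤ |π (u i)⁻| + δ := (abs_add_le _ _).trans (by gcongr)
  have hchain := le_sup_of_inf_eq_zero_of_le_add hsum
    (fun i => hπ.abs_apply_inf_abs_apply_eq_zero (posPart_inf_negPart_eq_zero (u i)))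
    (by simp [u, negPart_eq_zero.2 hy]) hstep n
  have hδ₀ : 0 ≤ δ := (abs_nonneg _).trans (hδ 0 le_rfl hv)
  simpa [u, posPart_eq_zero.2 (sub_nonpos.2 hyn), hδ₀] using hchain

theorem inf_negPart_apply_eq_zero_of_le (hE : IsArchimedeanRiesz E) (hπ : IsOrthomorphism π)
    {w x y : E} (hw : w ⊓ (π x)⁻ = 0) (hy : 0 ≤ y) (hyx : y ≤ x) : w ⊓ (π y)⁻ = 0 := by
  obtain ⟨h, hh⟩ := hπ.orderBounded.exists_abs_le_smul x
  have hx : 0 ≤ x := hy.trans hyx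
  refine le_antisymm (hE _ h fun ε hε => ?_) (le_inf (hw ▸ inf_le_left) (negPart_nonneg _))
  obtain ⟨n, hn⟩ := exists_nat_ge ε⁻¹
  refine hπ.inf_negPart_apply_le (n := n) (smul_nonneg hε.le hx) (hh ε hε) ?_ hy ?_
  · rw [map_smul, ← posPart_neg, ← smul_neg, posPart_smul_of_nonneg hε.le, posPart_neg, inf_comm]
    exact smul_inf_eq_zero ((inf_comm _ _).trans hw) hε.le
  · rw [← Nat.cast_smul_eq_nsmul ℝ, smul_smul]
    have hnε : 1 ≤ n * ε := (inv_le_iff_one_le_mul₀ hε).1 hn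
    exact hyx.trans (by simpa using smul_le_smul_of_nonneg_right hnε hx)

theorem posPart_apply_inf_negPart_apply_eq_zero (hE : IsArchimedeanRiesz E)
    (hπ : IsOrthomorphism π) {x y : E} (hx : 0 ≤ x) (hy : 0 ≤ y) : (π x)⁺ ⊓ (π y)⁻ = 0 := by
  have hdisj : (π (x + y))⁻ ⊓ (π x)⁺ = 0 := by
    have := hπ.neg.inf_negPart_apply_eq_zero_of_le hE (w := (π (x + y))⁻) (x := x + y) (y := x)
      (by rw [LinearMap.neg_apply, negPart_neg, inf_comm, posPart_inf_negPart_eq_zero]) hx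
      (le_add_of_nonneg_right hy)
    rwa [LinearMap.neg_apply, negPart_neg] at this
  exact hπ.inf_negPart_apply_eq_zero_of_le hE ((inf_comm _ _).trans hdisj) hy
    (le_add_of_nonneg_left hx)

theorem posPart_apply_add (hE : IsArchimedeanRiesz E) (hπ : IsOrthomorphism π) {x y : E}
    (hx : 0 ≤ x) (hy : 0 ≤ y) : (π (x + y))⁺ = (π x)⁺ + (π y)⁺ := by
  have hdisj {a b : E} (ha : 0 ≤ a) (hb : 0 ≤ b) : (π a)⁺ ⊓ (π b)⁻ = 0 :=
    hπ.posPart_apply_inf_negPart_apply_eq_zero hE ha hb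
  have hπxy : π (x + y) = (π x)⁺ + (π y)⁺ - ((π x)⁻ + (π y)⁻) := by
    rw [add_sub_add_comm, posPart_sub_negPart, posPart_sub_negPart, map_add]
  rw [hπxy]
  exact posPart_sub_of_inf_eq_zero <| add_inf_eq_zero
    (inf_add_eq_zero (hdisj hx hx) (hdisj hx hy)) (inf_add_eq_zero (hdisj hy hx) (hdisj hy hy))

theorem exists_apply_eq_posPart (hE : IsArchimedeanRiesz E) (hπ : IsOrthomorphism π) :
    ∃ P : E →ₗ[ℝ] E, IsOrthomorphism P ∧ Monotone P ∧ ∀ x, 0 ≤ x → P x = (π x)⁺ := by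
  obtain ⟨P, hP⟩ := exists_linearMap_eq_of_nonneg (fun x => (π x)⁺)
    (fun _ _ => hπ.posPart_apply_add hE)
    fun r x hr _ => by rw [map_smul, posPart_smul_of_nonneg hr]
  have hP_mono : Monotone P :=
    (monotone_iff_map_nonneg P).2 fun x hx => hP x hx ▸ posPart_nonneg _
  refine ⟨P, of_monotone hP_mono fun x y h => ?_, hP_mono, hP⟩
  rw [hP x (h ▸ inf_le_left)]
  exact inf_eq_zero_of_le_of_le (hπ.abs_apply_inf_eq_zero h) (posPart_nonneg _)
    (posPart_le_abs _) (h ▸ inf_le_right) le_rfl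

theorem exists_eq_sub_of_monotone (hE : IsArchimedeanRiesz E) (hπ : IsOrthomorphism π) :
    ∃ P N : E →ₗ[ℝ] E, IsOrthomorphism P ∧ IsOrthomorphism N ∧ Monotone P ∧ Monotone N ∧
      π = P - N := by
  obtain ⟨P, hP, hP_mono, hP_apply⟩ := hπ.exists_apply_eq_posPart hE
  obtain ⟨N, hN, hN_mono, hN_apply⟩ := hπ.neg.exists_apply_eq_posPart hE
  refine ⟨P, N, hP, hN, hP_mono, hN_mono, linearMap_ext_of_nonneg fun x hx => ?_⟩
  rw [LinearMap.sub_apply, hP_apply x hx, hN_apply x hx, LinearMap.neg_apply, posPart_neg,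
    posPart_sub_negPart]

theorem posPart_apply_apply_inf_eq_zero (hE : IsArchimedeanRiesz E) (hS : IsOrthomorphism S)
    (hT : IsOrthomorphism T) (hT_mono : Monotone T) {x : E} (hx : 0 ≤ x) :
    (S (T x))⁺ ⊓ T (S x)⁻ = 0 := by
  have hTx : 0 ≤ T x := by simpa using hT_mono hx
  have hdisj := hS.posPart_apply_inf_negPart_apply_eq_zero hE hTx hx
  rw [inf_comm] at hdisj ⊢
  exact hT.apply_inf_eq_zero hT_mono hdisj

theorem comp_sub_comp_le_sup (hE : IsArchimedeanRiesz E) (hS : IsOrthomorphism S)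
    (hS_mono : Monotone S) (hT : IsOrthomorphism T) (hT_mono : Monotone T) {x : E} (hx : 0 ≤ x)
    {ε : ℝ} (hε : 0 ≤ ε) (i : ℕ) :
    S (T x) - T (S x) ≤ ε • T x ⊔ (S (T x) - (i * ε) • T x)⁺ := by
  refine le_sup_of_inf_eq_zero_of_le_add (a := fun i : ℕ => (S (T x) - (i * ε) • T x)⁺)
    (b := fun i : ℕ => T (S x - (i * ε) • x)⁻) (fun i => ?_) (fun i => ?_) ?_ (fun i => ?_) i
  · calc S (T x) - T (S x) = (S (T x) - (i * ε) • T x) + T (-(S x - (i * ε) • x)) := by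
          rw [map_neg, map_sub, map_smul]
          abel
      _ ≤ _ := add_le_add (le_posPart _) (hT_mono (neg_le_negPart _))
  · exact (hS.sub (smul_id (by positivity))).posPart_apply_apply_inf_eq_zero hE hT hT_mono hx
  · have hSx : 0 ≤ S x := by simpa using hS_mono hx
    simp [negPart_eq_zero.2 hSx]
  · have hlevel : S x - ((i + 1 : ℕ) * ε) • x = S x - (i * ε) • x - ε • x := by
      rw [sub_sub, ← add_smul]
      push_cast
      ring_nf
    rw [hlevel, ← map_smul, ← map_add]
    exact hT_mono (negPart_sub_le_negPart_add _ (smul_nonneg hε hx))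

theorem posPart_apply_sub_smul_le (hS : IsOrthomorphism S) (hS_mono : Monotone S) {y : E}
    (hy : 0 ≤ y) {t : ℝ} (ht : 0 < t) : (S y - t • y)⁺ ≤ t⁻¹ • S (S y) := by
  have hSSy : 0 ≤ S (S y) := by simpa using hS_mono (hS_mono hy)
  refine sup_le ?_ (smul_nonneg (inv_pos.2 ht).le hSSy)
  rw [le_inv_smul_iff_of_pos ht, smul_sub, smul_smul, ← sq, sub_le_iff_le_add']
  exact hS.smul_apply_le hS_mono hy ht.le

theorem comp_le_comp_of_monotone (hE : IsArchimedeanRiesz E) (hS : IsOrthomorphism S)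
    (hS_mono : Monotone S) (hT : IsOrthomorphism T) (hT_mono : Monotone T) {x : E}
    (hx : 0 ≤ x) : S (T x) ≤ T (S x) := by
  have hTx : 0 ≤ T x := by simpa using hT_mono hx
  have hSSTx : 0 ≤ S (S (T x)) := by simpa using hS_mono (hS_mono hTx)
  rw [← sub_nonpos]
  refine hE _ (T x + S (S (T x))) fun ε hε => ?_
  obtain ⟨i, hi⟩ := exists_nat_ge (ε⁻¹ / ε)
  have hiε : ε⁻¹ ≤ i * ε := (div_le_iff₀ hε).1 hi
  have hiε_inv : (i * ε)⁻¹ ≤ ε := inv_le_of_inv_le₀ hε hiε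
  refine (comp_sub_comp_le_sup hE hS hS_mono hT hT_mono hx hε.le i).trans (sup_le ?_ ?_)
  · gcongr
    exact le_add_of_nonneg_right hSSTx
  · calc (S (T x) - (i * ε) • T x)⁺ ≤ (i * ε)⁻¹ • S (S (T x)) :=
          hS.posPart_apply_sub_smul_le hS_mono hTx ((inv_pos.2 hε).trans_le hiε)
      _ ≤ ε • S (S (T x)) := smul_le_smul_of_nonneg_right hiε_inv hSSTx
      _ ≤ ε • (T x + S (S (T x))) := by
          gcongr
          exact le_add_of_nonneg_left hTx

theorem comm_of_monotone (hE : IsArchimedeanRiesz E) (hS : IsOrthomorphism S)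
    (hS_mono : Monotone S) (hT : IsOrthomorphism T) (hT_mono : Monotone T) :
    S ∘ₗ T = T ∘ₗ S :=
  linearMap_ext_of_nonneg fun _ hx => le_antisymm
    (comp_le_comp_of_monotone hE hS hS_mono hT hT_mono hx)
    (comp_le_comp_of_monotone hE hT hT_mono hS hS_mono hx)

theorem comm (hE : IsArchimedeanRiesz E) (hS : IsOrthomorphism S) (hT : IsOrthomorphism T) :
    S ∘ₗ T = T ∘ₗ S := by
  obtain ⟨P, N, hP, hN, hP_mono, hN_mono, rfl⟩ := hS.exists_eq_sub_of_monotone hE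
  obtain ⟨P', N', hP', hN', hP'_mono, hN'_mono, rfl⟩ := hT.exists_eq_sub_of_monotone hE
  simp only [LinearMap.sub_comp, LinearMap.comp_sub]
  rw [comm_of_monotone hE hP hP_mono hP' hP'_mono, comm_of_monotone hE hP hP_mono hN' hN'_mono,
    comm_of_monotone hE hN hN_mono hP' hP'_mono, comm_of_monotone hE hN hN_mono hN' hN'_mono]
  abel

end IsOrthomorphism

end Riesz

section OrderDual

variable {E : Type u} [AddCommGroup E] [Lattice E] [IsOrderedAddMonoid E]
  [Module ℝ E] [IsOrderedModule ℝ E]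

namespace RieszDual

theorem isArchimedeanRiesz : IsArchimedeanRiesz (RieszDual E) := fun f g h x hx => by
  have hlim : Tendsto (fun ε : ℝ => ε * g x) (𝓝[>] 0) (𝓝 0) :=
    ((continuous_mul_const (g x)).tendsto' 0 0 (zero_mul _)).mono_left nhdsWithin_le_nhds
  exact ge_of_tendsto hlim (eventually_mem_nhdsWithin.mono fun ε hε => h ε hε x hx)

theorem monotone_of_nonneg {f : RieszDual E} (hf : 0 ≤ f) : Monotone f.toLin :=
  (monotone_iff_map_nonneg f.toLin).2 hf

omit [IsOrderedAddMonoid E] [IsOrderedModule ℝ E] in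
theorem sum_apply {ι : Type*} (s : Finset ι) (F : ι → RieszDual E) (x : E) :
    (∑ i ∈ s, F i) x = ∑ i ∈ s, F i x :=
  map_sum (AddMonoidHom.mk' (fun f : RieszDual E => f x) fun _ _ => rfl) F s

theorem sup_apply (f g : RieszDual E) {x : E} (hx : 0 ≤ x) :
    (f ⊔ g) x = g x + supIcc (f - g) x := by
  rw [← pos_apply _ hx]
  rfl

theorem inf_apply (f g : RieszDual E) {x : E} (hx : 0 ≤ x) :
    (f ⊓ g) x = f x - supIcc (f - g) x := by
  rw [← pos_apply _ hx]
  rfl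

theorem exists_add_lt_of_inf_eq_zero {f g : RieszDual E} (h : f ⊓ g = 0) {b : E} (hb : 0 ≤ b)
    {ε : ℝ} (hε : 0 < ε) : ∃ x, 0 ≤ x ∧ x ≤ b ∧ f x + g (b - x) < ε := by
  by_contra! hcon
  have hsup : supIcc (f - g) b ≤ f b - ε := by
    refine supIcc_le _ hb fun y hy hyb => ?_
    have := hcon (b - y) (sub_nonneg.2 hyb) (sub_le_self _ hy)
    rw [sub_sub_cancel, map_sub] at this
    rw [sub_apply]
    linarith
  have hinf := inf_apply f g hb
  rw [h, zero_apply] at hinf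
  linarith

theorem exists_abs_apply_lt_apply_add (f : RieszDual E) {x : E} (hx : 0 ≤ x) {ε : ℝ}
    (hε : 0 < ε) : ∃ v, |v| ≤ x ∧ |f| x < f v + ε := by
  by_contra! hcon
  have hsup : supIcc (f - -f) x ≤ |f| x - ε + f x := by
    refine supIcc_le _ hx fun y hy hyx => ?_
    have hv : |y + y - x| ≤ x := by
      refine sup_le (sub_le_iff_le_add.2 (add_le_add hyx hyx)) ?_
      rw [neg_sub]
      exact sub_le_self _ (add_nonneg hy hy)
    have := hcon (y + y - x) hv
    rw [map_sub, map_add] at this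
    rw [sub_apply, neg_apply]
    linarith
  have habs : |f| x = (-f) x + supIcc (f - -f) x := sup_apply f (-f) hx
  rw [neg_apply] at habs
  linarith

theorem tendsto_abs_apply (h : RieszDual E) {x : ℕ → E} (hx : ∀ n, 0 ≤ x n)
    (H : ∀ v : ℕ → E, (∀ n, |v n| ≤ x n) → Tendsto (fun n => h (v n)) atTop (𝓝 0)) :
    Tendsto (fun n => |h| (x n)) atTop (𝓝 0) := by
  choose v hv hlt using fun n : ℕ =>
    h.exists_abs_apply_lt_apply_add (hx n) (Nat.one_div_pos_of_nat (α := ℝ) (n := n))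
  have hlim := (H v hv).add (tendsto_one_div_add_atTop_nhds_zero_nat (𝕜 := ℝ))
  rw [add_zero] at hlim
  exact squeeze_zero (fun n => abs_nonneg h _ (hx n)) (fun n => (hlt n).le) hlim

theorem exists_hasSum_of_nonneg {F : ℕ → RieszDual E} (hF : ∀ n, 0 ≤ F n)
    (hsum : ∀ x, 0 ≤ x → Summable fun n => F n x) :
    ∃ s : RieszDual E, ∀ x, HasSum (fun n => F n x) (s x) := by
  have hsum' (x : E) : Summable fun n => F n x := by
    rw [← posPart_sub_negPart x]
    simpa only [map_sub] using (hsum _ (posPart_nonneg x)).sub (hsum _ (negPart_nonneg x))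
  let s : E →ₗ[ℝ] ℝ :=
    { toFun := fun x => ∑' n, F n x
      map_add' := fun x y => by simp only [map_add, (hsum' x).tsum_add (hsum' y)]
      map_smul' := fun r x => by
        simp only [map_smul, smul_eq_mul, tsum_mul_left, RingHom.id_apply] }
  have hs : IsOrderBoundedOp s :=
    isOrderBoundedOp_of_nonneg s fun x hx => tsum_nonneg fun n => hF n x hx
  exact ⟨mk s hs, fun x => (hsum' x).hasSum⟩

end RieszDual

namespace IsOrderContinuous

theorem tendsto_of_antitone {f : RieszDual E} (hf : IsOrderContinuous f) {x y : ℕ → E}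
    (hy : Antitone y) (hy₀ : IsGLB (Set.range y) 0) (hxy : ∀ n, |x n| ≤ y n) :
    Tendsto (fun n => f (x n)) atTop (𝓝 0) := by
  have hrange : Set.range (fun i : ULift.{u} ℕ => y i.down) = Set.range y :=
    ULift.down_surjective.range_comp y
  have hup : Tendsto (ULift.up : ℕ → ULift.{u} ℕ) atTop atTop :=
    tendsto_atTop.2 fun i => eventually_ge_atTop i.down
  exact (hf (ULift.{u} ℕ) (fun i => x i.down) (fun i => y i.down) (fun _ _ h => hy h)
    (hrange ▸ hy₀) fun i => hxy i.down).comp hup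

theorem tendsto_of_summable {G : RieszDual (RieszDual E)} (hG : IsOrderContinuous G)
    {F u : ℕ → RieszDual E} (hsum : ∀ x, 0 ≤ x → Summable fun n => F n x)
    (hu : ∀ n, |u n| ≤ F n) : Tendsto (fun n => G (u n)) atTop (𝓝 0) := by
  have hF (n : ℕ) : 0 ≤ F n := (abs_nonneg _).trans (hu n)
  obtain ⟨s, hs⟩ := RieszDual.exists_hasSum_of_nonneg hF hsum
  have hle (n : ℕ) : ∑ m ∈ Finset.range n, F m ≤ s := fun x hx => by
    rw [RieszDual.sum_apply]
    exact sum_le_hasSum _ (fun m _ => hF m x hx) (hs x)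
  refine hG.tendsto_of_antitone (y := fun n => s - ∑ m ∈ Finset.range n, F m) ?_ ⟨?_, ?_⟩
    fun n => (hu n).trans ?_
  · exact antitone_nat_of_succ_le fun n => by
      rw [Finset.sum_range_succ]
      exact sub_le_sub_left (le_add_of_nonneg_right (hF n)) s
  · rintro _ ⟨n, rfl⟩
    exact sub_nonneg.2 (hle n)
  · intro t ht x hx
    have hlim := (hs x).tendsto_sum_nat.const_sub (s x)
    rw [sub_self] at hlim
    refine ge_of_tendsto' hlim fun n => ?_
    simpa only [RieszDual.sub_apply, RieszDual.sum_apply] using ht ⟨n, rfl⟩ x hx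
  · rw [le_sub_iff_add_le', ← Finset.sum_range_succ]
    exact hle (n + 1)

end IsOrderContinuous

end OrderDual

section Arens

variable {A : Type u} [NonUnitalRing A] [Lattice A] [IsOrderedAddMonoid A] [Module ℝ A]
  [IsOrderedModule ℝ A] [IsScalarTower ℝ A A] [SMulCommClass ℝ A A] [IsFAlgebra A]

theorem IsFAlgebra.monotone_mulRight {c : A} (hc : 0 ≤ c) : Monotone (LinearMap.mulRight ℝ c) :=
  fun _ _ h => IsFAlgebra.mul_le_mul_right' h hc

theorem IsFAlgebra.isOrthomorphism_mulRight {c : A} (hc : 0 ≤ c) :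
    IsOrthomorphism (LinearMap.mulRight ℝ c) :=
  .of_monotone (monotone_mulRight hc) fun x y h => mul_right_inf x y c h hc

theorem abs_dualMul_le {f : RieszDual A} (hf : 0 ≤ f) {v x : A} (h : |v| ≤ x) :
    |dualMul f v| ≤ dualMul f x := by
  have hneg : -dualMul f v = dualMul f (-v) := RieszDual.ext_fun fun _ => by simp
  refine sup_le (dualMul_mono hf ((le_abs_self v).trans h)) ?_
  rw [hneg]
  exact dualMul_mono hf ((neg_le_abs v).trans h)

theorem mul_dualMul_apply_le {f : RieszDual A} (hf : 0 ≤ f) {x b c : A} (hx : 0 ≤ x)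
    (hxb : x ≤ b) (hc : 0 ≤ c) {k : ℝ} (hk : 0 ≤ k) :
    k * dualMul f x c ≤ k ^ 2 * f x + f (b * c * c) := by
  have hle : k • (x * c) ≤ k ^ 2 • x + b * c * c :=
    ((IsFAlgebra.isOrthomorphism_mulRight hc).smul_apply_le
      (IsFAlgebra.monotone_mulRight hc) hx hk).trans
      (add_le_add_right (IsFAlgebra.monotone_mulRight hc (IsFAlgebra.mul_le_mul_right' hxb hc)) _)
  simpa using RieszDual.monotone_of_nonneg hf hle

theorem summable_dualMul_apply {f : RieszDual A} (hf : 0 ≤ f) {b : A} {x : ℕ → A}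
    (hx : ∀ n, 0 ≤ x n) (hxb : ∀ n, x n ≤ b) (hfx : ∀ n, f (x n) ≤ (1 / 4) ^ n) {c : A}
    (hc : 0 ≤ c) : Summable fun n => dualMul f (x n) c := by
  refine Summable.of_nonneg_of_le (f := fun n => (1 / 2 : ℝ) ^ n * (1 + f (b * c * c)))
    (fun n => hf _ (IsFAlgebra.mul_nonneg _ _ (hx n) hc)) (fun n => ?_)
    (summable_geometric_two.mul_right _)
  have h2n : (0 : ℝ) < 2 ^ n := by positivity
  have hcancel : ((2 : ℝ) ^ n) ^ 2 * (1 / 4) ^ n = 1 := by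
    rw [← pow_mul, mul_comm n, pow_mul, ← mul_pow]
    norm_num
  rw [one_div, inv_pow, ← div_eq_inv_mul, le_div_iff₀' h2n]
  calc 2 ^ n * dualMul f (x n) c ≤ (2 ^ n) ^ 2 * f (x n) + f (b * c * c) :=
        mul_dualMul_apply_le hf (hx n) (hxb n) hc h2n.le
    _ ≤ (2 ^ n) ^ 2 * (1 / 4) ^ n + f (b * c * c) := by gcongr; exact hfx n
    _ = 1 + f (b * c * c) := by rw [hcancel]

theorem abs_bidualMul_inf_eq_zero {G : RieszDual (RieszDual A)} (hG : IsOrderContinuous G)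
    {f g : RieszDual A} (h : f ⊓ g = 0) : |bidualMul G f| ⊓ g = 0 := by
  have hf : 0 ≤ f := h ▸ inf_le_left
  have hg : 0 ≤ g := h ▸ inf_le_right
  refine le_antisymm (fun b hb => ?_) (le_inf (abs_nonneg _) hg)
  choose x hx hxb hlt using fun n : ℕ =>
    RieszDual.exists_add_lt_of_inf_eq_zero h hb (by positivity : (0 : ℝ) < (1 / 4) ^ n)
  have hf_nonneg (n : ℕ) : 0 ≤ f (x n) := hf _ (hx n)
  have hg_nonneg (n : ℕ) : 0 ≤ g (b - x n) := hg _ (sub_nonneg.2 (hxb n))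
  have habs : Tendsto (fun n => |bidualMul G f| (x n)) atTop (𝓝 0) :=
    (bidualMul G f).tendsto_abs_apply hx fun v hv => hG.tendsto_of_summable
      (fun _ => summable_dualMul_apply hf hx hxb fun n => by linarith [hlt n, hg_nonneg n])
      fun n => abs_dualMul_le hf (hv n)
  have hpow : Tendsto (fun n : ℕ => (1 / 4 : ℝ) ^ n) atTop (𝓝 0) :=
    tendsto_pow_atTop_nhds_zero_of_lt_one (by norm_num) (by norm_num)
  have hlim := habs.add hpow
  rw [add_zero] at hlim
  refine ge_of_tendsto' hlim fun n => ?_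
  calc (|bidualMul G f| ⊓ g) b
      = (|bidualMul G f| ⊓ g) (x n) + (|bidualMul G f| ⊓ g) (b - x n) := by
        rw [← map_add, add_sub_cancel]
    _ ≤ |bidualMul G f| (x n) + g (b - x n) :=
        add_le_add (RieszDual.le_def.1 inf_le_left _ (hx n))
          (RieszDual.le_def.1 inf_le_right _ (sub_nonneg.2 (hxb n)))
    _ ≤ |bidualMul G f| (x n) + (1 / 4) ^ n := by linarith [hlt n, hf_nonneg n]

/-- The Arens product `f ↦ G · f` by a fixed `G ∈ (A~)~`, as an operator on the order dual `A~`. -/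
noncomputable def bidualMulLin (G : RieszDual (RieszDual A)) : RieszDual A →ₗ[ℝ] RieszDual A where
  toFun := bidualMul G
  map_add' f g := RieszDual.ext_fun fun a => map_add G.toLin (dualMul f a) (dualMul g a)
  map_smul' r f := RieszDual.ext_fun fun a => map_smul G.toLin r (dualMul f a)

theorem monotone_bidualMulLin {G : RieszDual (RieszDual A)} (hG : 0 ≤ G) :
    Monotone (bidualMulLin G) := fun _ _ h a ha =>
  RieszDual.monotone_of_nonneg hG fun x hx => h _ (IsFAlgebra.mul_nonneg a x ha hx)

theorem isOrderBoundedOp_bidualMulLin (G : RieszDual (RieszDual A)) :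
    IsOrderBoundedOp (bidualMulLin G) := by
  have hsub : bidualMulLin G = bidualMulLin G⁺ - bidualMulLin G⁻ := by
    refine LinearMap.ext fun f => RieszDual.ext_fun fun a => ?_
    exact congrArg (fun H : RieszDual (RieszDual A) => H (dualMul f a)) (posPart_sub_negPart G).symm
  rw [hsub]
  exact (IsOrderBoundedOp.of_monotone (monotone_bidualMulLin (posPart_nonneg G))).sub
    (.of_monotone (monotone_bidualMulLin (negPart_nonneg G)))

theorem isOrthomorphism_bidualMulLin {G : RieszDual (RieszDual A)} (hG : IsOrderContinuous G) :
    IsOrthomorphism (bidualMulLin G) :=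
  .of_abs_apply_inf_eq_zero (isOrderBoundedOp_bidualMulLin G)
    fun _ _ => abs_bidualMul_inf_eq_zero hG

end Arens

theorem theorem3p1_general {A : Type u} [NonUnitalRing A] [Lattice A] [IsOrderedAddMonoid A]
    [Module ℝ A] [IsOrderedModule ℝ A] [IsScalarTower ℝ A A] [SMulCommClass ℝ A A]
    [IsFAlgebra A] (π : RieszDual A →ₗ[ℝ] RieszDual A) (hπ : IsOrthomorphism π) :
    IsFLinear π where
  orderBounded := hπ.orderBounded
  map_bidualMul _ hG f :=
    LinearMap.congr_fun
      (hπ.comm RieszDual.isArchimedeanRiesz (isOrthomorphism_bidualMulLin hG)) f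

theorem theorem3p1 {A : Type u} [NonUnitalRing A] [Lattice A] [IsOrderedAddMonoid A]
    [Module ℝ A] [IsOrderedModule ℝ A] [IsScalarTower ℝ A A] [SMulCommClass ℝ A A]
    [IsFAlgebra A] (hA : HasSeparatingOrderDual A)
    (π : RieszDual A →ₗ[ℝ] RieszDual A) (hπ : IsOrthomorphism π) : IsFLinear π :=
  theorem3p1_general π hπ
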